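/- Let $p\in[\frac12,1)$, $q:=1-p$, and let $d\ge 1$ be an integer. Let $(S_n)_{n\ge 0}$ be a random walk on $\mathbb{Z}$ with $S_0=0$ whose increments $X_n:=S_n-S_{n-1}$, $n\ge 1$, are mutually independent with $\mathrm{P}[X_n=+1]=p$ and $\mathrm{P}[X_n=-1]=q$. Let $R_n:=\#\{1\le k\le n: X_k=+1\}$ and $N_d:=\inf\{n\ge 0: S_n=d\}$. Then $N_d$ is almost surely finite, the win rate $R_{N_d}/N_d$ is square integrable, and, with $$h_p(u):=\frac{p-qu^2}{p+qu^2},\qquad \ell_p(u):=\ln\Big(\frac{p+qu^2}{u}\Big),$$ the functions $u\mapsto u^{d-1}h_p(u)$ and $u\mapsto u^{d-1}h_p(u)\ell_p(u)$ are integrable on $(0,1)$, and $$\mathrm{E}\Big[\frac{R_{N_d}}{N_d}\Big]=\frac12+\frac d2\int_0^1u^{d-1}h_p(u)\,du,$$ $$\mathrm{Var}\Big[\frac{R_{N_d}}{N_d}\Big]=\frac{d^2}{4}\bigg\{\int_0^1u^{d-1}h_p(u)\ell_p(u)\,du-\Big(\int_0^1u^{d-1}h_p(u)\,du\Big)^2\bigg\}.$$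 -/

import Mathlib

open MeasureTheory ProbabilityTheory

namespace WinRate

variable {Ω : Type*}

/-- The increment `X_{k+1} = S_{k+1} - S_k` of a process `S` on `ℤ`; thus `X_1, X_2, …` is
`incr S 0, incr S 1, …`. -/
def incr (S : ℕ → Ω → ℤ) (k : ℕ) (ω : Ω) : ℤ := S (k + 1) ω - S k ω

/-- `S` is a simple random walk on `ℤ` started at `0` under the measure `μ`: its increments are
mutually independent, equal to `+1` with probability `p` and to `-1` with probability `1 - p`. -/
structure IsBiasedWalk [MeasurableSpace Ω] (μ : Measure Ω) (p : ℝ) (S : ℕ → Ω → ℤ) : Prop where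
  measurable : ∀ n, Measurable (S n)
  zero : ∀ ω, S 0 ω = 0
  indep : iIndepFun (incr S) μ
  prob_up : ∀ k, μ.real {ω | incr S k ω = 1} = p
  prob_down : ∀ k, μ.real {ω | incr S k ω = -1} = 1 - p

/-- The number of wins `R_n = #{1 ≤ k ≤ n : X_k = +1}` up to time `n`. -/
def wins (S : ℕ → Ω → ℤ) (n : ℕ) (ω : Ω) : ℕ :=
  ((Finset.range n).filter (fun k => incr S k ω = 1)).card

/-- The first-passage time `N_d = inf {n ≥ 0 : S_n = d}`, with value `⊤` if `d` is never hit. -/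
noncomputable def firstPassage (S : ℕ → Ω → ℤ) (d : ℕ) : Ω → WithTop ℕ :=
  hittingAfter S {(d : ℤ)} 0

/-- The win rate `R_{N_d} / N_d` (an irrelevant constant where `N_d = ⊤`). -/
noncomputable def winRate (S : ℕ → Ω → ℤ) (d : ℕ) : Ω → ℝ :=
  stoppedValue (fun n ω => (wins S n ω : ℝ) / (n : ℝ)) (firstPassage S d)

/-- `h_p(u) = (p - q u²) / (p + q u²)` with `q = 1 - p`. -/
noncomputable def h (p u : ℝ) : ℝ := (p - (1 - p) * u ^ 2) / (p + (1 - p) * u ^ 2)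

/-- `ℓ_p(u) = ln ((p + q u²) / u)` with `q = 1 - p`. -/
noncomputable def ell (p u : ℝ) : ℝ := Real.log ((p + (1 - p) * u ^ 2) / u)

end WinRate

-- At the hitting time `N` of `d`, wins plus losses equal `N` and wins minus losses equal `d`, so
-- the win rate is `1/2 + (d/2) * (1/N)` (`winRate_eq`). Only the first two moments of `1/N` are
-- needed.
--
-- For `0 < u < 1` put `s = u / (p + q u²)`, with `q = 1 - p`. Then `s ^ n * u ^ (-S n)` is a
-- martingale, bounded up to time `N`, and optional stopping gives `E[s ^ N; N < ∞] = u ^ d`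
-- (`integral_pow_hitTime`). As `p ≥ 1/2`, `s < 1` on `(0,1)`, and letting `u → 1` gives `N < ∞`
-- almost surely.
--
-- Since `s' = s * h / u`, `ell = -log s`, and `s` runs from `0` to `1`, integrating `s ^ n` over
-- `(0,1)` against `h / u` gives `1/n`, and against `(h / u) * ell` gives `1/n²`. Setting `n = N`
-- and exchanging the integrals (`integral_comp_hitTime`) turns `s ^ N` into `u ^ d`.

namespace WinRate

variable {Ω : Type*}

/-- The first time `S` visits `d`, with the junk value `0` if it never does. -/
noncomputable def hitTime (S : ℕ → Ω → ℤ) (d : ℕ) (ω : Ω) : ℕ := sInf {n | S n ω = d}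

-- Pathwise facts about the hitting time and the win rate

section Path

variable {S : ℕ → Ω → ℤ} {d : ℕ} {ω : Ω}

/-- The walk starts at `0 ≠ d`, so time `0` is never a genuine hit and the junk value is
unambiguous. -/
lemma hitTime_eq_zero_iff (hd : 1 ≤ d) (h0 : S 0 ω = 0) :
    hitTime S d ω = 0 ↔ ∀ n, S n ω ≠ d := by
  unfold hitTime
  rw [Nat.sInf_eq_zero]
  constructor
  · rintro (h | h) n hn
    · simp only [Set.mem_ofPred_eq] at h; omega
    · have : n ∈ {n | S n ω = d} := hn
      simp [h] at this
  · intro h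
    right
    ext n
    simp [h n]

lemma hitTime_eq_iff {n : ℕ} (hn : n ≠ 0) :
    hitTime S d ω = n ↔ S n ω = d ∧ ∀ k < n, S k ω ≠ d := by
  constructor
  · intro h
    have hne : {n | S n ω = d}.Nonempty := Nat.nonempty_of_pos_sInf (by
      unfold hitTime at h; omega)
    refine ⟨?_, fun k hk hSk => ?_⟩
    · rw [← h]; exact Nat.sInf_mem hne
    · have : hitTime S d ω ≤ k := Nat.sInf_le hSk
      omega
  · rintro ⟨h1, h2⟩
    apply le_antisymm (Nat.sInf_le h1)
    by_contra! hlt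
    exact h2 _ hlt (Nat.sInf_mem (s := {n | S n ω = d}) ⟨n, h1⟩)

lemma firstPassage_eq_top_iff (hd : 1 ≤ d) (h0 : S 0 ω = 0) :
    firstPassage S d ω = ⊤ ↔ hitTime S d ω = 0 := by
  rw [hitTime_eq_zero_iff hd h0]
  simp [firstPassage, hittingAfter]

lemma firstPassage_eq_hitTime (hd : 1 ≤ d) (h0 : S 0 ω = 0) (h : hitTime S d ω ≠ 0) :
    firstPassage S d ω = WithTop.some (hitTime S d ω) := by
  have h' : ∃ j, S j ω = d := by
    by_contra! hc
    exact h ((hitTime_eq_zero_iff hd h0).2 hc)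
  simp [firstPassage, hittingAfter, hitTime, h']

lemma wins_succ (n : ℕ) :
    wins S (n + 1) ω = wins S n ω + if incr S n ω = 1 then 1 else 0 := by
  unfold wins
  rw [Finset.range_add_one, Finset.filter_insert]
  split_ifs with h
  · rw [Finset.card_insert_of_notMem (by simp)]
  · rfl

lemma two_mul_wins (h0 : S 0 ω = 0) (hX : ∀ k, incr S k ω = 1 ∨ incr S k ω = -1) (n : ℕ) :
    2 * (wins S n ω : ℤ) = n + S n ω := by
  induction n with
  | zero => simp [wins, h0]
  | succ n ih =>
    rw [wins_succ]
    rcases hX n with h | h <;> simp only [h] <;> simp only [incr] at h <;> push_cast <;>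
      norm_num <;> omega

lemma winRate_eq (hd : 1 ≤ d) (h0 : S 0 ω = 0) (hX : ∀ k, incr S k ω = 1 ∨ incr S k ω = -1)
    (hT : hitTime S d ω ≠ 0) :
    winRate S d ω = 1 / 2 + d / 2 * (1 / (hitTime S d ω : ℝ)) := by
  have h1 := two_mul_wins h0 hX (hitTime S d ω)
  rw [((hitTime_eq_iff hT).1 rfl).1] at h1
  have h2 : (2 : ℝ) * wins S (hitTime S d ω) ω = hitTime S d ω + d := by exact_mod_cast h1
  have h3 : (hitTime S d ω : ℝ) ≠ 0 := by exact_mod_cast hT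
  have h4 : winRate S d ω = (wins S (hitTime S d ω) ω : ℝ) / hitTime S d ω := by
    simp only [winRate, stoppedValue, firstPassage_eq_hitTime hd h0 hT]
    rfl
  rw [h4]
  field_simp
  linarith

/-- Steps of size one cannot jump over `d`. -/
lemma lt_of_forall_ne (hd : 1 ≤ d) (h0 : S 0 ω = 0)
    (hX : ∀ k, incr S k ω = 1 ∨ incr S k ω = -1) {n : ℕ} (hn : ∀ k ≤ n, S k ω ≠ d) :
    S n ω < d := by
  induction n with
  | zero => omega
  | succ n ih =>
    have h1 := ih (fun k hk => hn k (by omega))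
    have h2 := hn (n + 1) le_rfl
    have h3 := hX n
    simp only [incr] at h3
    omega

lemma eq_sum_incr (h0 : S 0 ω = 0) (n : ℕ) : S n ω = ∑ i ∈ Finset.range n, incr S i ω := by
  simp [incr, Finset.sum_range_sub (fun i => S i ω), h0]

end Path

-- The stopped exponential process along a path

open Classical in
/-- The exponential process `s ^ n * u ^ (-S n)`, killed on reaching `d`. -/
noncomputable def killedExp (S : ℕ → Ω → ℤ) (d : ℕ) (s u : ℝ) (n : ℕ) (ω : Ω) : ℝ :=
  if ∀ k ≤ n, S k ω ≠ d then s ^ n * u ^ (-S n ω) else 0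

/-- The exponential process `s ^ n * u ^ (-S n)`, stopped on reaching `d`. -/
noncomputable def stoppedExp (S : ℕ → Ω → ℤ) (d : ℕ) (s u : ℝ) (n : ℕ) (ω : Ω) : ℝ :=
  1 + ∑ k ∈ Finset.range n, killedExp S d s u k ω * (s * u ^ (-incr S k ω) - 1)

section Path

variable {S : ℕ → Ω → ℤ} {d : ℕ} {ω : Ω} {s u : ℝ}

lemma stoppedExp_of_forall_lt_ne (hu : 0 < u) (h0 : S 0 ω = 0) {n : ℕ}
    (hn : ∀ k < n, S k ω ≠ d) : stoppedExp S d s u n ω = s ^ n * u ^ (-S n ω) := by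
  induction n with
  | zero => simp [stoppedExp, h0]
  | succ n ih =>
    have h1 := ih (fun k hk => hn k (by omega))
    have h2 : stoppedExp S d s u (n + 1) ω = stoppedExp S d s u n ω +
        killedExp S d s u n ω * (s * u ^ (-incr S n ω) - 1) := by
      simp [stoppedExp, Finset.sum_range_succ, add_assoc]
    rw [h2, h1, killedExp, if_pos (fun k hk => hn k (by omega))]
    have h3 : u ^ (-S (n + 1) ω) = u ^ (-S n ω) * u ^ (-incr S n ω) := by
      rw [← zpow_add₀ hu.ne']
      congr 1
      simp only [incr]
      ring
    rw [h3]
    ring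

lemma stoppedExp_of_hit (hu : 0 < u) (h0 : S 0 ω = 0) {m n : ℕ} (hmn : m ≤ n)
    (hm : S m ω = d) (hlt : ∀ k < m, S k ω ≠ d) :
    stoppedExp S d s u n ω = s ^ m * u ^ (-(d : ℤ)) := by
  induction n, hmn using Nat.le_induction with
  | base => rw [stoppedExp_of_forall_lt_ne hu h0 hlt, hm]
  | succ n hn ih =>
    have h2 : stoppedExp S d s u (n + 1) ω = stoppedExp S d s u n ω +
        killedExp S d s u n ω * (s * u ^ (-incr S n ω) - 1) := by
      simp [stoppedExp, Finset.sum_range_succ, add_assoc]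
    rw [h2, ih, killedExp, if_neg (fun h => h m hn hm)]
    ring

/-- Before the hit `S n < d`, and `u < 1`. This is the source of the uniform bound needed for
dominated convergence, and of the decay on paths that never hit. -/
lemma exp_le (hu : 0 < u) (hu1 : u < 1) (hs : 0 ≤ s) (hd : 1 ≤ d) (h0 : S 0 ω = 0)
    (hX : ∀ k, incr S k ω = 1 ∨ incr S k ω = -1) {n : ℕ} (hn : ∀ k ≤ n, S k ω ≠ d) :
    s ^ n * u ^ (-S n ω) ≤ s ^ n * u ^ (-(d : ℤ)) := by
  have := lt_of_forall_ne hd h0 hX hn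
  exact mul_le_mul_of_nonneg_left
    (zpow_le_zpow_right_of_le_one₀ hu hu1.le (by omega)) (pow_nonneg hs n)

lemma norm_killedExp_le (hu : 0 < u) (hu1 : u < 1) (hs : 0 ≤ s) (hs1 : s ≤ 1) (hd : 1 ≤ d)
    (h0 : S 0 ω = 0) (hX : ∀ k, incr S k ω = 1 ∨ incr S k ω = -1) (n : ℕ) :
    ‖killedExp S d s u n ω‖ ≤ u ^ (-(d : ℤ)) := by
  have hpos : 0 < u ^ (-(d : ℤ)) := zpow_pos hu _
  unfold killedExp
  split_ifs with h
  · rw [Real.norm_of_nonneg (mul_nonneg (pow_nonneg hs n) (zpow_pos hu _).le)]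
    exact (exp_le hu hu1 hs hd h0 hX h).trans
      (mul_le_of_le_one_left hpos.le (pow_le_one₀ hs hs1))
  · simpa using hpos.le

lemma norm_stoppedExp_le (hu : 0 < u) (hu1 : u < 1) (hs : 0 ≤ s) (hs1 : s ≤ 1) (hd : 1 ≤ d)
    (h0 : S 0 ω = 0) (hX : ∀ k, incr S k ω = 1 ∨ incr S k ω = -1) (n : ℕ) :
    ‖stoppedExp S d s u n ω‖ ≤ u ^ (-(d : ℤ)) := by
  have hpos : 0 < u ^ (-(d : ℤ)) := zpow_pos hu _
  have key : ∀ m, s ^ m * u ^ (-(d : ℤ)) ≤ u ^ (-(d : ℤ)) := fun m =>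
    mul_le_of_le_one_left hpos.le (pow_le_one₀ hs hs1)
  by_cases h : ∀ k ≤ n, S k ω ≠ d
  · rw [stoppedExp_of_forall_lt_ne hu h0 (fun k hk => h k hk.le),
      Real.norm_of_nonneg (mul_nonneg (pow_nonneg hs n) (zpow_pos hu _).le)]
    exact (exp_le hu hu1 hs hd h0 hX h).trans (key n)
  · classical
    push Not at h
    have hex : ∃ k, S k ω = d := ⟨h.choose, h.choose_spec.2⟩
    have hle : Nat.find hex ≤ n := (Nat.find_min' hex h.choose_spec.2).trans h.choose_spec.1
    rw [stoppedExp_of_hit hu h0 hle (Nat.find_spec hex) (fun k hk => Nat.find_min hex hk),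
      Real.norm_of_nonneg (mul_nonneg (pow_nonneg hs _) hpos.le)]
    exact key _

lemma tendsto_stoppedExp (hu : 0 < u) (hu1 : u < 1) (hs : 0 ≤ s) (hs1 : s < 1) (hd : 1 ≤ d)
    (h0 : S 0 ω = 0) (hX : ∀ k, incr S k ω = 1 ∨ incr S k ω = -1) :
    Filter.Tendsto (fun n => stoppedExp S d s u n ω) Filter.atTop
      (nhds ((if hitTime S d ω = 0 then 0 else s ^ hitTime S d ω) * u ^ (-(d : ℤ)))) := by
  split_ifs with h
  · rw [hitTime_eq_zero_iff hd h0] at h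
    have hlim : Filter.Tendsto (fun n => s ^ n * u ^ (-(d : ℤ))) Filter.atTop
        (nhds (0 * u ^ (-(d : ℤ)))) :=
      (tendsto_pow_atTop_nhds_zero_of_lt_one hs hs1).mul_const _
    rw [zero_mul] at hlim ⊢
    refine squeeze_zero (fun n => ?_) (fun n => ?_) hlim
    · rw [stoppedExp_of_forall_lt_ne hu h0 (fun k _ => h k)]
      exact mul_nonneg (pow_nonneg hs n) (zpow_pos hu _).le
    · rw [stoppedExp_of_forall_lt_ne hu h0 (fun k _ => h k)]
      exact exp_le hu hu1 hs hd h0 hX (fun k _ => h k)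
  · obtain ⟨h1, h2⟩ := (hitTime_eq_iff h).1 rfl
    refine tendsto_const_nhds.congr' ?_
    filter_upwards [Filter.eventually_ge_atTop (hitTime S d ω)] with n hn
    rw [stoppedExp_of_hit hu h0 hn h1 h2]

/-- Dependence on the first `n` increments alone makes the killed process independent of `incr S n`.
-/
lemma killedExp_eq_comp (h0 : ∀ ω, S 0 ω = 0) (s u : ℝ) (n : ℕ) :
    ∃ g : (Finset.range n → ℤ) → ℝ,
      ∀ ω, killedExp S d s u n ω = g (fun i => incr S i ω) := by
  classical
  let path : (Finset.range n → ℤ) → ℕ → ℤ := fun x k =>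
    ∑ i ∈ Finset.range k, if hi : i ∈ Finset.range n then x ⟨i, hi⟩ else 0
  refine ⟨fun x => if ∀ k ≤ n, path x k ≠ d then s ^ n * u ^ (-path x n) else 0, fun ω => ?_⟩
  have hpath : ∀ k ≤ n, path (fun i => incr S i ω) k = S k ω := by
    intro k hk
    rw [eq_sum_incr (h0 ω)]
    refine Finset.sum_congr rfl fun i hi => ?_
    rw [dif_pos (Finset.mem_range.2 ((Finset.mem_range.1 hi).trans_le hk))]
  have hiff : (∀ k ≤ n, path (fun i => incr S i ω) k ≠ d) ↔ ∀ k ≤ n, S k ω ≠ d :=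
    forall₂_congr fun k hk => by rw [hpath k hk]
  simp only [killedExp, hpath n le_rfl, hiff]

end Path

-- Optional stopping and the generating function

section Probability

variable [MeasurableSpace Ω] {μ : Measure Ω} {p : ℝ} {S : ℕ → Ω → ℤ} {d : ℕ}

lemma IsBiasedWalk.measurable_incr (hS : IsBiasedWalk μ p S) (k : ℕ) : Measurable (incr S k) :=
  (hS.measurable (k + 1)).sub (hS.measurable k)

lemma IsBiasedWalk.measurable_hitTime (hS : IsBiasedWalk μ p S) : Measurable (hitTime S d) := by
  have hset : ∀ n k, MeasurableSet {ω | S n ω = k} := fun n k =>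
    hS.measurable n (measurableSet_singleton k)
  have hpos : ∀ n : ℕ, n ≠ 0 → MeasurableSet (hitTime S d ⁻¹' {n}) := fun n hn => by
    have : hitTime S d ⁻¹' {n} = {ω | S n ω = d} ∩ ⋂ k < n, {ω | S k ω = d}ᶜ := by
      ext ω
      simp [hitTime_eq_iff hn]
    rw [this]
    exact (hset n d).inter (MeasurableSet.biInter (Set.to_countable _) fun k _ => (hset k d).compl)
  refine measurable_to_countable' fun n => ?_
  rcases eq_or_ne n 0 with rfl | hn
  · have : hitTime S d ⁻¹' {0} = (⋃ n : ℕ, hitTime S d ⁻¹' {n + 1})ᶜ := by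
      ext ω
      simp only [Set.mem_preimage, Set.mem_singleton_iff, Set.mem_compl_iff, Set.mem_iUnion,
        not_exists]
      exact ⟨fun h n => by omega, fun h => by
        by_contra h'
        exact h (hitTime S d ω - 1) (by omega)⟩
    rw [this]
    exact (MeasurableSet.iUnion fun n => hpos _ (by omega)).compl
  · exact hpos n hn

lemma IsBiasedWalk.measurable_killedExp (hS : IsBiasedWalk μ p S) (s u : ℝ) (n : ℕ) :
    Measurable (killedExp S d s u n) := by
  obtain ⟨g, hg⟩ := killedExp_eq_comp (d := d) hS.zero s u n
  rw [show killedExp S d s u n = g ∘ fun ω i => incr S i ω from funext hg]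
  exact (Measurable.of_discrete (f := g)).comp
    (measurable_pi_lambda _ fun i => hS.measurable_incr i)

variable [IsProbabilityMeasure μ]

lemma IsBiasedWalk.ae_incr (hS : IsBiasedWalk μ p S) :
    ∀ᵐ ω ∂μ, ∀ k, incr S k ω = 1 ∨ incr S k ω = -1 := by
  rw [ae_all_iff]
  intro k
  have h1 : MeasurableSet {ω | incr S k ω = 1} :=
    hS.measurable_incr k (measurableSet_singleton 1)
  have h2 : MeasurableSet {ω | incr S k ω = -1} :=
    hS.measurable_incr k (measurableSet_singleton (-1))
  have h3 : μ.real ({ω | incr S k ω = 1} ∪ {ω | incr S k ω = -1}) = 1 := by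
    rw [measureReal_union _ h2, hS.prob_up, hS.prob_down]
    · ring
    · rw [Set.disjoint_left]
      intro ω h h'
      simp only [Set.mem_ofPred_eq] at h h'
      omega
  have h4 : μ ({ω | incr S k ω = 1} ∪ {ω | incr S k ω = -1}) = 1 := by
    rw [measureReal_def] at h3
    rwa [ENNReal.toReal_eq_one_iff] at h3
  exact (mem_ae_iff_prob_eq_one (h1.union h2)).2 h4

lemma IsBiasedWalk.integral_comp_incr (hS : IsBiasedWalk μ p S) (k : ℕ) (f : ℤ → ℝ) :
    ∫ ω, f (incr S k ω) ∂μ = p * f 1 + (1 - p) * f (-1) := by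
  have h1 : MeasurableSet {ω | incr S k ω = 1} :=
    hS.measurable_incr k (measurableSet_singleton 1)
  have h2 : MeasurableSet {ω | incr S k ω = -1} :=
    hS.measurable_incr k (measurableSet_singleton (-1))
  have h3 : (fun ω => f (incr S k ω)) =ᵐ[μ] fun ω =>
      {ω | incr S k ω = 1}.indicator (fun _ => f 1) ω +
      {ω | incr S k ω = -1}.indicator (fun _ => f (-1)) ω := by
    filter_upwards [hS.ae_incr] with ω hω
    rcases hω k with h | h <;> simp [h]
  rw [integral_congr_ae h3, integral_add ((integrable_const _).indicator h1)
    ((integrable_const _).indicator h2), integral_indicator_const _ h1,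
    integral_indicator_const _ h2, hS.prob_up, hS.prob_down]
  simp

lemma IsBiasedWalk.integral_killedExp_mul (hS : IsBiasedWalk μ p S) (s u : ℝ) (n : ℕ)
    (f : ℤ → ℝ) :
    ∫ ω, killedExp S d s u n ω * f (incr S n ω) ∂μ =
      (∫ ω, killedExp S d s u n ω ∂μ) * (p * f 1 + (1 - p) * f (-1)) := by
  obtain ⟨g, hg⟩ := killedExp_eq_comp (d := d) hS.zero s u n
  have hind := hS.indep.indepFun_finset (Finset.range n) {n} (by simp) hS.measurable_incr
  have := hind.integral_fun_comp_mul_comp (𝕜 := ℝ) (f := g)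
    (g := fun y => f (y ⟨n, Finset.mem_singleton_self n⟩))
    (measurable_pi_lambda _ fun i : Finset.range n => hS.measurable_incr i).aemeasurable
    (measurable_pi_lambda _ fun i : ({n} : Finset ℕ) => hS.measurable_incr i).aemeasurable
    Measurable.of_discrete.aestronglyMeasurable Measurable.of_discrete.aestronglyMeasurable
  simp only [hg]
  rw [this, hS.integral_comp_incr]

/-- Each summand of `stoppedExp` is a function of the past times an independent factor of mean `s *
(p / u + (1 - p) * u) - 1 = 0`, so no conditional expectation is needed. -/
lemma IsBiasedWalk.integral_stoppedExp (hS : IsBiasedWalk μ p S) (hd : 1 ≤ d) {s u : ℝ}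
    (hu : 0 < u) (hu1 : u < 1) (hs : 0 ≤ s) (hs1 : s ≤ 1) (hsu : s * (p / u + (1 - p) * u) = 1)
    (n : ℕ) : ∫ ω, stoppedExp S d s u n ω ∂μ = 1 := by
  have hint : ∀ k, Integrable
      (fun ω => killedExp S d s u k ω * (s * u ^ (-incr S k ω) - 1)) μ := by
    intro k
    refine Integrable.of_bound (C := u ^ (-(d : ℤ)) * (|s * u⁻¹ - 1| + |s * u - 1|)) ?_ ?_
    · exact ((hS.measurable_killedExp s u k).mul ((Measurable.of_discrete
        (f := fun x : ℤ => s * u ^ (-x) - 1)).comp (hS.measurable_incr k))).aestronglyMeasurable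
    · filter_upwards [hS.ae_incr] with ω hω
      rw [norm_mul]
      refine mul_le_mul (norm_killedExp_le hu hu1 hs hs1 hd (hS.zero ω) hω k) ?_
        (norm_nonneg _) (zpow_pos hu _).le
      rcases hω k with h | h <;> simp [h]
  unfold stoppedExp
  rw [integral_add (integrable_const _) (integrable_finsetSum _ fun k _ => hint k),
    integral_finsetSum _ fun k _ => hint k]
  have hz : ∀ k, ∫ ω, killedExp S d s u k ω * (s * u ^ (-incr S k ω) - 1) ∂μ = 0 := by
    intro k
    rw [hS.integral_killedExp_mul s u k fun x => s * u ^ (-x) - 1]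
    have : p * (s * u ^ (-1 : ℤ) - 1) + (1 - p) * (s * u ^ (-(-1) : ℤ) - 1) = 0 := by
      simp only [neg_neg, zpow_one, zpow_neg]
      linear_combination hsu
    rw [this, mul_zero]
  simp only [hz]
  simp

/-- The generating function of the first-passage time. -/
lemma IsBiasedWalk.integral_pow_hitTime (hS : IsBiasedWalk μ p S) (hd : 1 ≤ d) {s u : ℝ}
    (hu : 0 < u) (hu1 : u < 1) (hs : 0 ≤ s) (hs1 : s < 1)
    (hsu : s * (p / u + (1 - p) * u) = 1) :
    ∫ ω, (if hitTime S d ω = 0 then 0 else s ^ hitTime S d ω) ∂μ = u ^ d := by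
  have hlim : Filter.Tendsto (fun n => ∫ ω, stoppedExp S d s u n ω ∂μ) Filter.atTop (nhds
      (∫ ω, (if hitTime S d ω = 0 then 0 else s ^ hitTime S d ω) * u ^ (-(d : ℤ)) ∂μ)) := by
    refine tendsto_integral_of_dominated_convergence (fun _ => u ^ (-(d : ℤ))) (fun n => ?_)
      (integrable_const _) (fun n => ?_) ?_
    · refine (measurable_const.add (Finset.measurable_sum _ fun k _ =>
        (hS.measurable_killedExp s u k).mul ?_)).aestronglyMeasurable
      exact (Measurable.of_discrete (f := fun x : ℤ => s * u ^ (-x) - 1)).comp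
        (hS.measurable_incr k)
    · filter_upwards [hS.ae_incr] with ω hω
      exact norm_stoppedExp_le hu hu1 hs hs1.le hd (hS.zero ω) hω n
    · filter_upwards [hS.ae_incr] with ω hω
      exact tendsto_stoppedExp hu hu1 hs hs1 hd (hS.zero ω) hω
  simp only [hS.integral_stoppedExp hd hu hu1 hs hs1.le hsu] at hlim
  have := tendsto_nhds_unique hlim tendsto_const_nhds
  rw [integral_mul_const, zpow_neg, zpow_natCast, ← div_eq_mul_inv,
    div_eq_one_iff_eq (pow_pos hu d).ne'] at this
  exact this

end Probability

end WinRate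

-- Integrals of powers of the discount factor

namespace WinRate

/-- The discount factor `s` for which `s ^ n * u ^ (-S n)` is a martingale. -/
noncomputable def discount (p u : ℝ) : ℝ := u / (p + (1 - p) * u ^ 2)

section Discount

variable {p u : ℝ}

lemma denom_pos (hp : 1 / 2 ≤ p) (hp1 : p < 1) (u : ℝ) : 0 < p + (1 - p) * u ^ 2 := by
  have := mul_nonneg (sub_nonneg.2 hp1.le) (sq_nonneg u)
  linarith

lemma discount_pos (hp : 1 / 2 ≤ p) (hp1 : p < 1) (hu : 0 < u) : 0 < discount p u :=
  div_pos hu (denom_pos hp hp1 u)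

lemma discount_lt_one (hp : 1 / 2 ≤ p) (hp1 : p < 1) (hu1 : u < 1) : discount p u < 1 := by
  rw [discount, div_lt_one (denom_pos hp hp1 u)]
  -- The denominator minus `u` factors as `(1 - u) * (p - (1 - p) * u)`; `p ≥ 1/2` makes the second
  -- factor positive.
  have : 0 < p - (1 - p) * u := by
    have := mul_lt_mul_of_pos_left hu1 (sub_pos.2 hp1)
    linarith
  linarith [mul_pos (sub_pos.2 hu1) this]

lemma discount_mul (hp : 1 / 2 ≤ p) (hp1 : p < 1) (hu : 0 < u) :
    discount p u * (p / u + (1 - p) * u) = 1 := by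
  have := (denom_pos hp hp1 u).ne'
  rw [show p / u + (1 - p) * u = (p + (1 - p) * u ^ 2) / u by field_simp, discount,
    div_mul_div_cancel₀ this, div_self hu.ne']

lemma continuous_discount (hp : 1 / 2 ≤ p) (hp1 : p < 1) : Continuous (discount p) :=
  continuous_id.div (by fun_prop) fun u => (denom_pos hp hp1 u).ne'

lemma h_nonneg (hp : 1 / 2 ≤ p) (hp1 : p < 1) (hu : 0 < u) (hu1 : u < 1) : 0 ≤ h p u := by
  have : u ^ 2 ≤ 1 := pow_le_one₀ hu.le hu1.le
  have := mul_le_mul_of_nonneg_left this (sub_nonneg.2 hp1.le)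
  exact div_nonneg (by linarith) (denom_pos hp hp1 u).le

lemma ell_eq_neg_log_discount (p u : ℝ) : ell p u = -Real.log (discount p u) := by
  rw [ell, discount, ← Real.log_inv, inv_div]

lemma ell_nonneg (hp : 1 / 2 ≤ p) (hp1 : p < 1) (hu : 0 < u) (hu1 : u < 1) : 0 ≤ ell p u := by
  rw [ell_eq_neg_log_discount]
  exact neg_nonneg.2 (Real.log_nonpos (discount_pos hp hp1 hu).le (discount_lt_one hp hp1 hu1).le)

lemma hasDerivAt_discount (hp : 1 / 2 ≤ p) (hp1 : p < 1) (hu : 0 < u) :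
    HasDerivAt (discount p) (discount p u * (h p u / u)) u := by
  have h0 := (denom_pos hp hp1 u).ne'
  have h1 : HasDerivAt (fun v => p + (1 - p) * v ^ 2) ((1 - p) * (2 * u)) u := by
    simpa using ((hasDerivAt_pow 2 u).const_mul (1 - p)).const_add p
  refine ((hasDerivAt_id u).fun_div h1 h0).congr_deriv ?_
  unfold discount h
  simp only [id]
  field_simp
  ring

end Discount

/-- Nonnegativity of the derivative supplies its integrability, so nothing is required of `g'` at
the endpoints. -/
lemma lintegral_deriv_of_nonneg {g g' : ℝ → ℝ} (hcont : ContinuousOn g (Set.Icc 0 1))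
    (hderiv : ∀ x ∈ Set.Ioo (0 : ℝ) 1, HasDerivAt g (g' x) x)
    (hpos : ∀ x ∈ Set.Ioo (0 : ℝ) 1, 0 ≤ g' x) :
    ∫⁻ x in Set.Ioo (0 : ℝ) 1, ENNReal.ofReal (g' x) = ENNReal.ofReal (g 1 - g 0) := by
  have hint := intervalIntegral.integrableOn_deriv_of_nonneg hcont hderiv hpos
  rw [← intervalIntegral.integral_eq_sub_of_hasDerivAt_of_le zero_le_one hcont hderiv
    ((intervalIntegrable_iff_integrableOn_Ioc_of_le zero_le_one).2 hint),
    intervalIntegral.integral_of_le zero_le_one, integral_Ioc_eq_integral_Ioo,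
    ofReal_integral_eq_lintegral_ofReal (hint.mono_set Set.Ioo_subset_Ioc_self)
      ((ae_restrict_iff' measurableSet_Ioo).2 (Filter.Eventually.of_forall hpos))]

section Weights

variable {p : ℝ}

lemma discount_zero (p : ℝ) : discount p 0 = 0 := by simp [discount]

lemma discount_one (p : ℝ) : discount p 1 = 1 := by simp [discount]

lemma lintegral_discount_pow (hp : 1 / 2 ≤ p) (hp1 : p < 1) {n : ℕ} (hn : n ≠ 0) :
    ∫⁻ u in Set.Ioo (0 : ℝ) 1, ENNReal.ofReal (discount p u ^ n * (h p u / u)) =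
      ENNReal.ofReal (1 / n) := by
  have hn' : (n : ℝ) ≠ 0 := by exact_mod_cast hn
  rw [lintegral_deriv_of_nonneg (g := fun u => discount p u ^ n / n)
    (((continuous_discount hp hp1).pow n).div_const _).continuousOn]
  · simp [discount_zero, discount_one, hn]
  · rintro u ⟨hu, -⟩
    refine (((hasDerivAt_discount hp hp1 hu).fun_pow n).div_const (n : ℝ)).congr_deriv ?_
    rw [mul_assoc, mul_div_cancel_left₀ _ hn', ← mul_assoc, pow_sub_one_mul hn]
  · rintro u ⟨hu, hu1⟩
    exact mul_nonneg (pow_nonneg (discount_pos hp hp1 hu).le n)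
      (div_nonneg (h_nonneg hp hp1 hu hu1) hu.le)

lemma lintegral_discount_pow_mul_ell (hp : 1 / 2 ≤ p) (hp1 : p < 1) {n : ℕ} (hn : n ≠ 0) :
    ∫⁻ u in Set.Ioo (0 : ℝ) 1, ENNReal.ofReal (discount p u ^ n * (h p u / u * ell p u)) =
      ENNReal.ofReal ((1 / n) ^ 2) := by
  have hn' : (n : ℝ) ≠ 0 := by exact_mod_cast hn
  obtain ⟨m, rfl⟩ := Nat.exists_eq_succ_of_ne_zero hn
  simp only [Nat.succ_eq_add_one] at *
  have hc := continuous_discount hp hp1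
  -- With `n = m + 1`, the antiderivative is `s ^ n / n² - s ^ n * log s / n`. One factor `s` is
  -- kept next to `log s` because `x * log x` is continuous at `0`.
  rw [lintegral_deriv_of_nonneg (g := fun u => discount p u ^ (m + 1) / ((m + 1 : ℕ) : ℝ) ^ 2 -
    discount p u ^ m * (discount p u * Real.log (discount p u)) / ((m + 1 : ℕ) : ℝ))]
  · simp [discount_zero, discount_one]
  · exact (((hc.pow _).div_const _).sub
      (((hc.pow m).mul (Real.continuous_mul_log.comp hc)).div_const _)).continuousOn
  · rintro u ⟨hu, -⟩
    have hs := discount_pos hp hp1 hu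
    have hD := hasDerivAt_discount hp hp1 hu
    have h1 := (hD.fun_pow (m + 1)).div_const (((m + 1 : ℕ) : ℝ) ^ 2)
    have h2 := ((hD.fun_pow (m + 1)).fun_mul (hD.log hs.ne')).div_const (((m + 1 : ℕ) : ℝ))
    convert! h1.fun_sub h2 using 1
    · ext v
      ring
    · rw [ell_eq_neg_log_discount]
      simp only [Nat.add_sub_cancel]
      field_simp
      ring
  · rintro u ⟨hu, hu1⟩
    exact mul_nonneg (pow_nonneg (discount_pos hp hp1 hu).le _)
      (mul_nonneg (div_nonneg (h_nonneg hp hp1 hu hu1) hu.le) (ell_nonneg hp hp1 hu hu1))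

end Weights

-- Almost sure finiteness and moments of the reciprocal hitting time

section Probability

variable {Ω : Type*} [MeasurableSpace Ω] {μ : Measure Ω} [IsProbabilityMeasure μ] {p : ℝ}
  {S : ℕ → Ω → ℤ} {d : ℕ}

lemma IsBiasedWalk.ae_hitTime_ne_zero (hS : IsBiasedWalk μ p S) (hp : 1 / 2 ≤ p) (hp1 : p < 1)
    (hd : 1 ≤ d) : ∀ᵐ ω ∂μ, hitTime S d ω ≠ 0 := by
  have hmeas : MeasurableSet {ω | hitTime S d ω ≠ 0} :=
    (hS.measurable_hitTime (measurableSet_singleton 0)).compl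
  -- The generating function is at most the hitting probability, since `s ^ N ≤ 1`.
  have hle : ∀ u ∈ Set.Ioo (0 : ℝ) 1, u ^ d ≤ μ.real {ω | hitTime S d ω ≠ 0} := by
    rintro u ⟨hu, hu1⟩
    have hs := discount_pos hp hp1 hu
    have hs1 := discount_lt_one hp hp1 hu1
    rw [← hS.integral_pow_hitTime hd hu hu1 hs.le hs1 (discount_mul hp hp1 hu),
      ← integral_indicator_one hmeas]
    refine integral_mono_of_nonneg (Filter.Eventually.of_forall fun ω => ?_)
      ((integrable_const 1).indicator hmeas) (Filter.Eventually.of_forall fun ω => ?_)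
    · dsimp only
      split_ifs
      · exact le_rfl
      · exact pow_nonneg hs.le _
    · dsimp only
      split_ifs with h
      · simp [h]
      · simpa [h] using pow_le_one₀ hs.le hs1.le
  have hlim : Filter.Tendsto (fun u : ℝ => u ^ d) (nhdsWithin 1 (Set.Iio 1)) (nhds 1) := by
    have : Filter.Tendsto (fun u : ℝ => u ^ d) (nhds 1) (nhds (1 ^ d)) :=
      (continuous_pow d).tendsto 1
    rw [one_pow] at this
    exact this.mono_left nhdsWithin_le_nhds
  have hone : 1 ≤ μ.real {ω | hitTime S d ω ≠ 0} := by
    refine le_of_tendsto hlim ?_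
    filter_upwards [Ioo_mem_nhdsLT (zero_lt_one' ℝ)] with u hu using hle u hu
  have heq := le_antisymm measureReal_le_one hone
  rw [measureReal_def, ENNReal.toReal_eq_one_iff] at heq
  exact (mem_ae_iff_prob_eq_one hmeas).2 heq

/-- If `c n` is the integral of `discount p ^ n` against a weight `w`, then the mean of `c` at the
first-passage time is the integral of `u ^ d` against `w`. -/
lemma IsBiasedWalk.integral_comp_hitTime (hS : IsBiasedWalk μ p S) (hp : 1 / 2 ≤ p) (hp1 : p < 1)
    (hd : 1 ≤ d) {w : ℝ → ℝ} (hw : Measurable w) (hw0 : ∀ u ∈ Set.Ioo (0 : ℝ) 1, 0 ≤ w u)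
    {c : ℕ → ℝ} (hc0 : ∀ n, 0 ≤ c n) (hc1 : ∀ n, c n ≤ 1)
    (hc : ∀ n ≠ 0, ∫⁻ u in Set.Ioo (0 : ℝ) 1, ENNReal.ofReal (discount p u ^ n * w u) =
      ENNReal.ofReal (c n)) :
    IntegrableOn (fun u => u ^ d * w u) (Set.Ioo 0 1) ∧
      ∫ ω, c (hitTime S d ω) ∂μ = ∫ u in Set.Ioo (0 : ℝ) 1, u ^ d * w u := by
  have hT : Measurable (hitTime S d) := hS.measurable_hitTime
  have hcT : Integrable (fun ω => c (hitTime S d ω)) μ :=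
    Integrable.of_bound (Measurable.of_discrete.comp hT).aestronglyMeasurable 1
      (Filter.Eventually.of_forall fun ω => by
        rw [Real.norm_of_nonneg (hc0 _)]
        exact hc1 _)
  have hnn : ∀ᵐ u ∂volume.restrict (Set.Ioo (0 : ℝ) 1), 0 ≤ u ^ d * w u :=
    (ae_restrict_iff' measurableSet_Ioo).2 (Filter.Eventually.of_forall fun u hu =>
      mul_nonneg (pow_nonneg hu.1.le d) (hw0 u hu))
  have hmw : AEStronglyMeasurable (fun u => u ^ d * w u) (volume.restrict (Set.Ioo (0 : ℝ) 1)) :=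
    ((measurable_id.pow_const d).mul hw).aestronglyMeasurable
  have hinner : ∀ u ∈ Set.Ioo (0 : ℝ) 1,
      ∫⁻ ω, ENNReal.ofReal (discount p u ^ hitTime S d ω * w u) ∂μ =
        ENNReal.ofReal (u ^ d * w u) := by
    rintro u ⟨hu, hu1⟩
    have hs := discount_pos hp hp1 hu
    have hs1 := discount_lt_one hp hp1 hu1
    rw [← hS.integral_pow_hitTime hd hu hu1 hs.le hs1 (discount_mul hp hp1 hu),
      ← integral_mul_const, ← ofReal_integral_eq_lintegral_ofReal]
    · congr 1
      refine integral_congr_ae ?_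
      filter_upwards [hS.ae_hitTime_ne_zero hp hp1 hd] with ω hω
      simp [hω]
    · refine Integrable.mul_const ?_ _
      refine Integrable.of_bound (measurable_const.pow hT).aestronglyMeasurable 1
        (Filter.Eventually.of_forall fun ω => ?_)
      rw [Real.norm_of_nonneg (pow_nonneg hs.le _)]
      exact pow_le_one₀ hs.le hs1.le
    · exact Filter.Eventually.of_forall fun ω =>
        mul_nonneg (pow_nonneg hs.le _) (hw0 u ⟨hu, hu1⟩)
  -- Tonelli needs no integrability; that of `u ^ d * w u` is then inherited from the bounded `c`.
  have hswap : ∫⁻ ω, ENNReal.ofReal (c (hitTime S d ω)) ∂μ =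
      ∫⁻ u in Set.Ioo (0 : ℝ) 1, ENNReal.ofReal (u ^ d * w u) := by
    rw [← setLIntegral_congr_fun measurableSet_Ioo hinner, ← lintegral_lintegral_swap]
    · refine lintegral_congr_ae ?_
      filter_upwards [hS.ae_hitTime_ne_zero hp hp1 hd] with ω hω
      rw [hc _ hω]
    · refine (ENNReal.measurable_ofReal.comp (Measurable.mul ?_ ?_)).aemeasurable
      · exact ((continuous_discount hp hp1).measurable.comp measurable_snd).pow
          (hT.comp measurable_fst)
      · exact hw.comp measurable_snd
  constructor
  · rw [IntegrableOn, ← lintegral_ofReal_ne_top_iff_integrable hmw hnn, ← hswap]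
    exact (lintegral_ofReal_ne_top_iff_integrable hcT.aestronglyMeasurable
      (Filter.Eventually.of_forall fun ω => hc0 _)).2 hcT
  · rw [integral_eq_lintegral_of_nonneg_ae (Filter.Eventually.of_forall fun ω => hc0 _)
      hcT.aestronglyMeasurable, hswap, integral_eq_lintegral_of_nonneg_ae hnn hmw]

end Probability

lemma measurable_h (p : ℝ) : Measurable (h p) := by
  unfold h
  fun_prop

lemma measurable_ell (p : ℝ) : Measurable (ell p) := by
  unfold ell
  fun_prop

end WinRate

-- Mean and variance of the win rate

theorem theorem1 {Ω : Type*} [MeasurableSpace Ω] (μ : Measure Ω) [IsProbabilityMeasure μ]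
    (p : ℝ) (hp : 1 / 2 ≤ p) (hp1 : p < 1) (d : ℕ) (hd : 1 ≤ d)
    (S : ℕ → Ω → ℤ) (hS : WinRate.IsBiasedWalk μ p S) :
    (∀ᵐ ω ∂μ, WinRate.firstPassage S d ω ≠ ⊤) ∧
    MemLp (WinRate.winRate S d) 2 μ ∧
    IntervalIntegrable (fun u => u ^ (d - 1) * WinRate.h p u) volume 0 1 ∧
    IntervalIntegrable (fun u => u ^ (d - 1) * WinRate.h p u * WinRate.ell p u) volume 0 1 ∧
    ∫ ω, WinRate.winRate S d ω ∂μ =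
      1 / 2 + (d : ℝ) / 2 * ∫ u in (0 : ℝ)..1, u ^ (d - 1) * WinRate.h p u ∧
    variance (WinRate.winRate S d) μ =
      (d : ℝ) ^ 2 / 4 *
        ((∫ u in (0 : ℝ)..1, u ^ (d - 1) * WinRate.h p u * WinRate.ell p u) -
          (∫ u in (0 : ℝ)..1, u ^ (d - 1) * WinRate.h p u) ^ 2) := by
  have hT := hS.ae_hitTime_ne_zero hp hp1 hd
  -- The convention `1 / 0 = 0` covers `n = 0`.
  have hb : ∀ n : ℕ, (1 : ℝ) / n ≤ 1 := fun n => by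
    simpa using Nat.cast_inv_le_one n
  have hb0 : ∀ n : ℕ, (0 : ℝ) ≤ 1 / n := fun n => by positivity
  have hmean := hS.integral_comp_hitTime hp hp1 hd (w := fun u => WinRate.h p u / u)
    (c := fun n => 1 / n) ((WinRate.measurable_h p).div measurable_id)
    (fun u hu => div_nonneg (WinRate.h_nonneg hp hp1 hu.1 hu.2) hu.1.le) hb0 hb
    (fun n hn => WinRate.lintegral_discount_pow hp hp1 hn)
  have hsq := hS.integral_comp_hitTime hp hp1 hd
    (w := fun u => WinRate.h p u / u * WinRate.ell p u) (c := fun n => (1 / n) ^ 2)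
    (((WinRate.measurable_h p).div measurable_id).mul (WinRate.measurable_ell p))
    (fun u hu => mul_nonneg (div_nonneg (WinRate.h_nonneg hp hp1 hu.1 hu.2) hu.1.le)
      (WinRate.ell_nonneg hp hp1 hu.1 hu.2))
    (fun n => sq_nonneg _) (fun n => pow_le_one₀ (hb0 n) (hb n))
    (fun n hn => WinRate.lintegral_discount_pow_mul_ell hp hp1 hn)
  have hpow : ∀ u ∈ Set.Ioo (0 : ℝ) 1, u ^ d * (WinRate.h p u / u) =
      u ^ (d - 1) * WinRate.h p u := by
    rintro u ⟨hu, -⟩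
    obtain ⟨m, rfl⟩ := Nat.exists_eq_add_of_le' hd
    rw [Nat.add_sub_cancel]
    field_simp
    ring
  have hpow' : ∀ u ∈ Set.Ioo (0 : ℝ) 1, u ^ d * (WinRate.h p u / u * WinRate.ell p u) =
      u ^ (d - 1) * WinRate.h p u * WinRate.ell p u := fun u hu => by
    rw [← mul_assoc, hpow u hu]
  rw [integrableOn_congr_fun hpow measurableSet_Ioo,
    setIntegral_congr_fun measurableSet_Ioo hpow, ← integral_Ioc_eq_integral_Ioo,
    ← intervalIntegral.integral_of_le zero_le_one,
    ← integrableOn_Ioc_iff_integrableOn_Ioo,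
    ← intervalIntegrable_iff_integrableOn_Ioc_of_le zero_le_one] at hmean
  rw [integrableOn_congr_fun hpow' measurableSet_Ioo,
    setIntegral_congr_fun measurableSet_Ioo hpow', ← integral_Ioc_eq_integral_Ioo,
    ← intervalIntegral.integral_of_le zero_le_one,
    ← integrableOn_Ioc_iff_integrableOn_Ioo,
    ← intervalIntegrable_iff_integrableOn_Ioc_of_le zero_le_one] at hsq
  have hY : MemLp (fun ω => 1 / (WinRate.hitTime S d ω : ℝ)) 2 μ :=
    MemLp.of_bound ((Measurable.of_discrete (f := fun n : ℕ => 1 / (n : ℝ))).comp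
      hS.measurable_hitTime).aestronglyMeasurable 1 (Filter.Eventually.of_forall fun ω => by
        rw [Real.norm_of_nonneg (hb0 _)]
        exact hb _)
  have hW : WinRate.winRate S d =ᵐ[μ]
      fun ω => 1 / 2 + d / 2 * (1 / (WinRate.hitTime S d ω : ℝ)) := by
    filter_upwards [hT, hS.ae_incr] with ω hω hX
    exact WinRate.winRate_eq hd (hS.zero ω) hX hω
  refine ⟨?_, ?_, hmean.1, hsq.1, ?_, ?_⟩
  · filter_upwards [hT] with ω hω
    rwa [ne_eq, WinRate.firstPassage_eq_top_iff hd (hS.zero ω)]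
  · have hX : MemLp (fun ω => (d : ℝ) / 2 * (1 / (WinRate.hitTime S d ω : ℝ))) 2 μ :=
      hY.const_mul _
    have hc : MemLp (fun _ : Ω => (1 / 2 : ℝ)) 2 μ := memLp_const _
    exact MemLp.ae_eq hW.symm (hc.add hX)
  · have hX : Integrable (fun ω => (d : ℝ) / 2 * (1 / (WinRate.hitTime S d ω : ℝ))) μ :=
      (hY.integrable one_le_two).const_mul _
    rw [integral_congr_ae hW, integral_add (integrable_const _) hX, integral_const_mul, hmean.2]
    simp
  · have hm : AEStronglyMeasurable
        (fun ω => (d : ℝ) / 2 * (1 / (WinRate.hitTime S d ω : ℝ))) μ := hY.1.const_mul _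
    rw [variance_congr hW, variance_const_add hm, variance_const_mul, variance_eq_sub hY]
    simp only [Pi.pow_apply]
    rw [hsq.2, hmean.2]
    ring
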